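/- There is an absolute constant $c>0$ such that the following holds for every dimension $d\ge 1$ and every $D>0$. There is a nonempty compact convex set $\mathcal X\subset\mathbb R^d$ with $\|x-y\|\le D$ for all $x,y\in\mathcal X$ such that for all $G>0$ and $\alpha>0$ there is $T_0$ (which may depend on $d,D,\mathcal X,G,\alpha$, but not on $k$ or on the algorithm) with the following property. For all $T\ge T_0$, all integers $0\le k\le T$ and every online convex optimization algorithm on $\mathcal X$, i.e. every rule that chooses each action $x_t\in\mathcal X$ from complete knowledge of the previous loss functions $f_1,\dots,f_{t-1}$ and possibly from internal randomness (and that may depend on $\mathcal X,d,D,G,\alpha,T,k$), there are loss functions $f_1,\dots,f_T$, convex on $\mathcal X$, differentiable at every point of $\mathcal X$ with $\|\nabla f_t(x)\|\le G$ for all $x\in\mathcal X$ and all $t$, which are $k$-contaminated $\alpha$-exp-concave, i.e. there is a set $I\subset\{1,\dots,T\}$ with $|I|=k$ such that $x\mapsto\exp(-\alpha f_t(x))$ is concave on $\mathcal X$ for every $t\notin I$, and for which the regret $$R_T=\sum_{t=1}^T f_t(x_t)-\min_{x\in\mathcal X}\sum_{t=1}^T f_t(x)$$ of the algorithm is integrable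 and satisfies $$\mathbb E[R_T]\ \ge\ c\left(\frac d\alpha\log T+GD\sqrt k\right),$$ where the expectation is over the internal randomness of the algorithm (for a deterministic algorithm, $R_T$ itself satisfies the bound). -/

import Mathlib

open MeasureTheory

noncomputable section

/-- `f` is `α`-exp-concave on `X`: the function `x ↦ exp (-α f x)` is concave on `X`. -/
def ExpConcaveOn {d : ℕ} (α : ℝ) (X : Set (EuclideanSpace ℝ (Fin d)))
    (f : EuclideanSpace ℝ (Fin d) → ℝ) : Prop :=
  ConcaveOn ℝ X (fun x => Real.exp (-α * f x))

/-- The sequence `f₁, …, f_T` of functions that are convex on `X` is `k`-contaminated `F`: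
there is a set of exactly `k` rounds outside of which all the functions belong to `F`. -/
def IsContaminated {d T : ℕ} (X : Set (EuclideanSpace ℝ (Fin d)))
    (F : Set (EuclideanSpace ℝ (Fin d) → ℝ)) (k : ℕ)
    (f : Fin T → EuclideanSpace ℝ (Fin d) → ℝ) : Prop :=
  (∀ t, ConvexOn ℝ X (f t)) ∧ ∃ I : Finset (Fin T), I.card = k ∧ ∀ t, t ∉ I → f t ∈ F

/-- An algorithm for online convex optimization on the decision set `X`. Given the complete
loss functions of the `n` previous rounds and an internal random seed `ω : Ω`, it chooses the
next action, a point of `X`. A deterministic algorithm is the case of a one-point `Ω`. -/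
structure OCOAlgorithm {d : ℕ} (X : Set (EuclideanSpace ℝ (Fin d)))
    (Ω : Type*) [MeasurableSpace Ω] where
  play : (n : ℕ) → (Fin n → EuclideanSpace ℝ (Fin d) → ℝ) → Ω → EuclideanSpace ℝ (Fin d)
  play_mem : ∀ n h ω, play n h ω ∈ X
  measurable_play : ∀ n h, Measurable (play n h)

/-- The action in round `t` (rounds are numbered from `0`) against the losses `f`: it is
computed from the losses of the rounds before `t` only. -/
def OCOAlgorithm.action {d T : ℕ} {X : Set (EuclideanSpace ℝ (Fin d))} {Ω : Type*}
    [MeasurableSpace Ω] (A : OCOAlgorithm X Ω) (f : Fin T → EuclideanSpace ℝ (Fin d) → ℝ)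
    (t : Fin T) (ω : Ω) : EuclideanSpace ℝ (Fin d) :=
  A.play t (fun s : Fin t => f (Fin.castLE t.isLt.le s)) ω

/-- The regret for the outcome `ω` of the internal randomness:
`∑ t, f_t(x_t) - min_{x ∈ X} ∑ t, f_t(x)`. (The infimum is attained if `X` is compact and
nonempty and the losses are continuous on `X`.) -/
def OCOAlgorithm.regret {d T : ℕ} {X : Set (EuclideanSpace ℝ (Fin d))} {Ω : Type*}
    [MeasurableSpace Ω] (A : OCOAlgorithm X Ω) (f : Fin T → EuclideanSpace ℝ (Fin d) → ℝ)
    (ω : Ω) : ℝ :=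
  (∑ t, f t (A.action f t ω)) - sInf ((fun x => ∑ t, f t x) '' X)

end

/-! Take for `X` the cube of diameter `D`. Up to a factor 2 it suffices to force the larger of the
two terms, each by its own family of losses indexed by signs. By Jensen the random actions may be
replaced by their means, which depend on past signs only.

Logarithmic term: round `t` is assigned coordinate `t % d` and has the log loss of predicting a
sign. Regret is then `1 / α` times the log of a likelihood ratio between a constant parameter and
the algorithm. The algorithm's likelihoods form a probability on sign sequences
(`sum_prod_nonanticipating`). Put `m ^ d` parameters on a grid so coarse that their product measures
live, up to mass `1 / 2`, on disjoint sets (Chebyshev). One probability cannot be comparable to all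
of them, so on some sequence a grid point wins by the factor `m ^ d / 2` (`exists_prod_le_prod`).
The admissible `m` is of order `T ^ (1 / 4)`, which gives a multiple of `d / α * log T`.

Contamination term: on the `k` contaminated rounds play a linear loss along the diagonal of the cube
with random sign, elsewhere the zero loss. On average the algorithm gains nothing, while the better
of two opposite corners gains the absolute value of a random walk, of order `√k` by Khintchine
(`sum_abs_signs_ge`). -/

/-- The sign `±1` encoded by a Boolean. -/
def boolSign (b : Bool) : ℝ := if b then 1 else -1

@[simp] lemma boolSign_true : boolSign true = 1 := rfl

@[simp] lemma boolSign_false : boolSign false = -1 := rfl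

lemma abs_boolSign (b : Bool) : |boolSign b| = 1 := by cases b <;> simp

/-! ### Nonanticipating processes on sign sequences -/

/-- `z t s` depends only on the signs `s r` of the rounds `r < t`. -/
def Nonanticipating {T : ℕ} (z : Fin T → (Fin T → Bool) → ℝ) : Prop :=
  ∀ t s s', (∀ r, r < t → s r = s' r) → z t s = z t s'

lemma sum_snoc {T : ℕ} (F : (Fin (T + 1) → Bool) → ℝ) :
    ∑ s, F s = ∑ s : Fin T → Bool,
      (F (Fin.snoc (α := fun _ => Bool) s true) + F (Fin.snoc (α := fun _ => Bool) s false)) := by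
  rw [← (Fin.snocEquiv (fun _ : Fin (T + 1) => Bool)).sum_comp, Fintype.sum_prod_type_right]
  simp [Fin.snocEquiv]

/-- Supplies the induction step on the number of rounds; the appended sign `true` is arbitrary,
since no prediction sees the last sign. -/
lemma Nonanticipating.init {T : ℕ} {z : Fin (T + 1) → (Fin (T + 1) → Bool) → ℝ}
    (hz : Nonanticipating z) :
    Nonanticipating (fun (t : Fin T) s =>
      z t.castSucc (Fin.snoc (α := fun _ => Bool) s true)) := by
  intro t s s' h
  apply hz
  intro r hr
  have hrT : (r : ℕ) < T := lt_trans (Fin.lt_def.1 hr) t.isLt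
  obtain ⟨r', rfl⟩ : ∃ r' : Fin T, r = r'.castSucc := ⟨⟨r, hrT⟩, rfl⟩
  simpa using h r' (by simpa using hr)

lemma Nonanticipating.snoc_eq {T : ℕ} {z : Fin (T + 1) → (Fin (T + 1) → Bool) → ℝ}
    (hz : Nonanticipating z) (t : Fin (T + 1)) (s : Fin T → Bool) (b : Bool) :
    z t (Fin.snoc (α := fun _ => Bool) s b) = z t (Fin.snoc (α := fun _ => Bool) s true) := by
  apply hz
  intro r hr
  have hrT : (r : ℕ) < T := lt_of_lt_of_le (Fin.lt_def.1 hr) (Nat.lt_succ_iff.1 t.isLt)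
  obtain ⟨r', rfl⟩ : ∃ r' : Fin T, r = r'.castSucc := ⟨⟨r, hrT⟩, rfl⟩
  simp

/-- The likelihoods assigned by a sequential predictor add up to one. -/
lemma sum_prod_nonanticipating {T : ℕ} (z : Fin T → (Fin T → Bool) → ℝ)
    (hz : Nonanticipating z) :
    ∑ s, ∏ t, ((1 + boolSign (s t) * z t s) / 2) = 1 := by
  induction T with
  | zero => simp
  | succ T ih =>
    refine Eq.trans ?_ (ih _ hz.init)
    rw [sum_snoc]
    refine Finset.sum_congr rfl fun s _ => ?_
    simp only [Fin.prod_univ_castSucc, Fin.snoc_castSucc, Fin.snoc_last, hz.snoc_eq _ s false,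
      boolSign_true, boolSign_false]
    ring

/-- The signed sum of a nonanticipating process has mean zero. -/
lemma sum_sum_nonanticipating {T : ℕ} (z : Fin T → (Fin T → Bool) → ℝ)
    (hz : Nonanticipating z) :
    ∑ s, ∑ t, boolSign (s t) * z t s = 0 := by
  induction T with
  | zero => simp
  | succ T ih =>
    rw [sum_snoc]
    simp only [Fin.sum_univ_castSucc, Fin.snoc_castSucc, Fin.snoc_last, hz.snoc_eq _ _ false,
      boolSign_true, boolSign_false]
    have h := ih _ hz.init
    calc _ = ∑ s : Fin T → Bool, 2 * ∑ t : Fin T, boolSign (s t) *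
          z t.castSucc (Fin.snoc (α := fun _ => Bool) s true) :=
        Finset.sum_congr rfl fun s _ => by ring
      _ = 0 := by rw [← Finset.mul_sum, h, mul_zero]

lemma nonanticipating_const {T : ℕ} (p : Fin T → ℝ) :
    Nonanticipating (fun t (_ : Fin T → Bool) => p t) := fun _ _ _ _ => rfl

/-! ### Moments of weighted sign sums -/

/-- The variance of a weighted sum of independent signs with means `p t`, around any centre. -/
lemma sum_prod_mul_sq {T : ℕ} (p a : Fin T → ℝ) (c : ℝ) :
    ∑ s : Fin T → Bool, (∏ t, ((1 + boolSign (s t) * p t) / 2)) *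
      (c + ∑ t, a t * (boolSign (s t) - p t)) ^ 2 = c ^ 2 + ∑ t, a t ^ 2 * (1 - p t ^ 2) := by
  induction T generalizing c with
  | zero => simp
  | succ T ih =>
    rw [sum_snoc]
    simp only [Fin.prod_univ_castSucc, Fin.sum_univ_castSucc, Fin.snoc_castSucc, Fin.snoc_last,
      boolSign_true, boolSign_false]
    set u := p (Fin.last T)
    set v := a (Fin.last T)
    -- The two values of the last sign merely move the centre, which is why the induction is over
    -- all `c`.
    have h1 := ih (fun t => p t.castSucc) (fun t => a t.castSucc) (c + v * (1 - u))
    have h2 := ih (fun t => p t.castSucc) (fun t => a t.castSucc) (c + v * (-1 - u))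
    calc _ = (1 + u) / 2 * (∑ s : Fin T → Bool, (∏ t : Fin T,
            ((1 + boolSign (s t) * p t.castSucc) / 2)) * (c + v * (1 - u) +
            ∑ t : Fin T, a t.castSucc * (boolSign (s t) - p t.castSucc)) ^ 2)
          + (1 - u) / 2 * (∑ s : Fin T → Bool, (∏ t : Fin T,
            ((1 + boolSign (s t) * p t.castSucc) / 2)) * (c + v * (-1 - u) +
            ∑ t : Fin T, a t.castSucc * (boolSign (s t) - p t.castSucc)) ^ 2) := by
          rw [Finset.mul_sum, Finset.mul_sum, ← Finset.sum_add_distrib]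
          exact Finset.sum_congr rfl fun s _ => by ring
      _ = _ := by rw [h1, h2]; ring

lemma sum_sq_signs {T : ℕ} (a : Fin T → ℝ) :
    ∑ s : Fin T → Bool, (∑ t, a t * boolSign (s t)) ^ 2 = 2 ^ T * ∑ t, a t ^ 2 := by
  have h := sum_prod_mul_sq (fun _ => 0) a 0
  simp only [mul_zero, add_zero, Finset.prod_const, Finset.card_univ, Fintype.card_fin, sub_zero,
    zero_add, ← Finset.mul_sum, ne_eq, OfNat.ofNat_ne_zero, not_false_eq_true, zero_pow,
    mul_one] at h
  rw [← h, ← mul_assoc, ← mul_pow]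
  norm_num

/-- Averaging over the last sign kills the odd powers: `(S + v) ^ 4 + (S - v) ^ 4 = 2 * S ^ 4 + 12 *
v ^ 2 * S ^ 2 + 2 * v ^ 4`. -/
lemma sum_pow_four_signs_le {T : ℕ} (a : Fin T → ℝ) :
    ∑ s : Fin T → Bool, (∑ t, a t * boolSign (s t)) ^ 4 ≤ 2 ^ T * (3 * (∑ t, a t ^ 2) ^ 2) := by
  induction T with
  | zero => simp
  | succ T ih =>
    rw [sum_snoc]
    simp only [Fin.sum_univ_castSucc, Fin.snoc_castSucc, Fin.snoc_last, boolSign_true,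
      boolSign_false]
    set v := a (Fin.last T)
    have h4 := ih (fun t => a t.castSucc)
    have h2 := sum_sq_signs (fun t : Fin T => a t.castSucc)
    have hc : ∑ _s : Fin T → Bool, (1 : ℝ) = 2 ^ T := by simp
    calc _ = 2 * (∑ s : Fin T → Bool, (∑ t : Fin T, a t.castSucc * boolSign (s t)) ^ 4)
          + 12 * v ^ 2 * (∑ s : Fin T → Bool, (∑ t : Fin T, a t.castSucc * boolSign (s t)) ^ 2)
          + 2 * v ^ 4 * ∑ _s : Fin T → Bool, (1 : ℝ) := by
          rw [Finset.mul_sum, Finset.mul_sum, Finset.mul_sum, ← Finset.sum_add_distrib,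
            ← Finset.sum_add_distrib]
          exact Finset.sum_congr rfl fun s _ => by ring
      _ ≤ _ := by
          rw [h2, hc, pow_succ (2 : ℝ) T]
          have : 0 ≤ (2 : ℝ) ^ T * v ^ 4 := by positivity
          nlinarith

/-- Khintchine's inequality for the first moment, in the averaged form. -/
lemma sum_abs_signs_ge {T : ℕ} (a : Fin T → ℝ) :
    2 ^ T * (5 / 9 * √(∑ t, a t ^ 2)) ≤ ∑ s : Fin T → Bool, |∑ t, a t * boolSign (s t)| := by
  set V := ∑ t, a t ^ 2 with hV
  have hV0 : 0 ≤ V := Finset.sum_nonneg fun _ _ => sq_nonneg _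
  rcases hV0.eq_or_lt with h0 | hpos
  · rw [← h0]; simp only [Real.sqrt_zero, mul_zero]
    exact Finset.sum_nonneg fun _ _ => abs_nonneg _
  set q := √V
  have hq : 0 < q := Real.sqrt_pos.2 hpos
  have hqV : V = q ^ 2 := (Real.sq_sqrt hV0).symm
  -- With `y = |x| / q` this is `y ^ 2 - 4 / 27 * y ^ 4 ≤ y`, tangent at `y = 3 / 2`. The moment
  -- bounds then give `1 - 3 * 4 / 27 = 5 / 9`.
  have key : ∀ x : ℝ, x ^ 2 / q - 4 / 27 * (x ^ 4 / q ^ 3) ≤ |x| := by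
    intro x
    have hy : 0 ≤ |x| / q := by positivity
    set y := |x| / q with hydef
    have hx : |x| = y * q := by rw [hydef]; field_simp
    have h2 : x ^ 2 = (y * q) ^ 2 := by rw [← hx, sq_abs]
    have h4 : x ^ 4 = (y * q) ^ 4 := by
      calc x ^ 4 = (x ^ 2) ^ 2 := by ring
        _ = _ := by rw [h2]; ring
    rw [h2, h4, hx]
    have e : (y * q) ^ 2 / q - 4 / 27 * ((y * q) ^ 4 / q ^ 3) = (y ^ 2 - 4 / 27 * y ^ 4) * q := by
      field_simp
    rw [e]
    refine mul_le_mul_of_nonneg_right ?_ hq.le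
    have : 0 ≤ y * ((y - 3 / 2) ^ 2 * (4 / 27 * y + 4 / 9)) := by positivity
    nlinarith
  have h2 := sum_sq_signs a
  have h4 := sum_pow_four_signs_le a
  calc 2 ^ T * (5 / 9 * q)
      = (2 ^ T * V) / q - 4 / 27 * ((2 ^ T * (3 * V ^ 2)) / q ^ 3) := by
        rw [hqV]; field_simp; ring
    _ ≤ (∑ s : Fin T → Bool, (∑ t, a t * boolSign (s t)) ^ 2) / q
        - 4 / 27 * ((∑ s : Fin T → Bool, (∑ t, a t * boolSign (s t)) ^ 4) / q ^ 3) := by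
        rw [h2]; gcongr
    _ = ∑ s : Fin T → Bool, ((∑ t, a t * boolSign (s t)) ^ 2 / q
        - 4 / 27 * ((∑ t, a t * boolSign (s t)) ^ 4 / q ^ 3)) := by
        rw [Finset.sum_sub_distrib, ← Finset.mul_sum, Finset.sum_div, Finset.sum_div]
    _ ≤ _ := Finset.sum_le_sum fun s _ => key _

/-! ### Likelihood of a predictor against a grid of parameters -/

/-- If the weights `P j` give mass at least `1/2` to disjoint sets `A j`, then some `P j` exceeds
a given subprobability `q` somewhere by a factor of half the number of indices. -/
lemma exists_mul_le_of_disjoint {S J : Type*} [Fintype S] [Nonempty S] [Fintype J]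
    (q : S → ℝ) (hq : ∀ s, 0 < q s) (hq1 : ∑ s, q s ≤ 1) [Nonempty J]
    (P : J → S → ℝ) (A : J → S → Prop)
    [∀ j s, Decidable (A j s)] (hA : ∀ s j j', A j s → A j' s → j = j')
    (hP : ∀ j, 1 / 2 ≤ ∑ s, if A j s then P j s else 0) :
    ∃ s j, (Fintype.card J : ℝ) / 2 * q s ≤ P j s := by
  by_contra! h
  set M : ℝ := (Fintype.card J : ℝ) / 2 with hM
  have hMpos : 0 < M := by
    have : 0 < Fintype.card J := Fintype.card_pos
    positivity
  have h1 : M ≤ ∑ s, ∑ j, if A j s then P j s else 0 := by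
    rw [Finset.sum_comm]
    calc M = ∑ _j : J, (1 / 2 : ℝ) := by simp [hM, div_eq_mul_inv]
      _ ≤ _ := Finset.sum_le_sum fun j _ => hP j
  -- Disjointness leaves at most one term for each `s`; positivity of `q` makes the bound strict
  -- where none is left.
  have h2 : ∑ s, (∑ j, if A j s then P j s else 0) < ∑ s, M * q s := by
    refine Finset.sum_lt_sum_of_nonempty Finset.univ_nonempty fun s _ => ?_
    by_cases hs : ∃ j, A j s
    · obtain ⟨j, hj⟩ := hs
      rw [Finset.sum_eq_single j]
      · simpa [hj] using h s j
      · intro j' _ hne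
        rw [if_neg fun h' => hne (hA s j' j h' hj)]
      · simp
    · push Not at hs
      simp only [hs, if_false, Finset.sum_const_zero]
      exact mul_pos hMpos (hq s)
  rw [← Finset.mul_sum] at h2
  nlinarith

/-- A sequential predictor of signs, one of `d` parameters being in charge of each round, is
beaten by some constant choice of parameters by a factor `m ^ d / 2`. -/
lemma exists_prod_le_prod {T d m : ℕ} (hm : 0 < m) (hT : 0 < T) (i : Fin T → Fin d) (δ N : ℝ)
    (hδ1 : δ < 1) (hN : 0 < N)
    (hi : ∀ l, N ≤ ((Finset.univ.filter fun t => i t = l).card : ℝ))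
    (hmN : m * √(8 * T) ≤ δ * N)
    (z : Fin T → (Fin T → Bool) → ℝ) (hz : Nonanticipating z) (hzδ : ∀ t s, |z t s| ≤ δ) :
    ∃ s : Fin T → Bool, ∃ θ : Fin d → ℝ, (∀ l, |θ l| ≤ δ) ∧
      (m : ℝ) ^ d / 2 * ∏ t, (1 + boolSign (s t) * z t s) ≤
        ∏ t, (1 + boolSign (s t) * θ (i t)) := by
  classical
  have : NeZero m := ⟨hm.ne'⟩
  -- `8` makes the Chebyshev failure probability at radius `g / 2` at most `4 * T / g ^ 2 = 1 / 2`.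
  set g := √(8 * T : ℝ) with hg
  have hTr : (0 : ℝ) < T := by exact_mod_cast hT
  have hgpos : 0 < g := Real.sqrt_pos.2 (by positivity)
  have hg2 : g ^ 2 = 8 * T := Real.sq_sqrt (by positivity)
  set n : Fin d → ℝ := fun l => ((Finset.univ.filter fun t => i t = l).card : ℝ) with hn
  have hnpos : ∀ l, 0 < n l := fun l => hN.trans_le (hi l)
  have hnsum : ∀ l, ∑ t, (if i t = l then (1 : ℝ) else 0) = n l := by
    intro l; simp [hn]
  have hδ0 : 0 ≤ δ := (abs_nonneg _).trans (hzδ ⟨0, hT⟩ fun _ => true)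
  -- Under `θ j` the signs of block `l` have expected sum `j l * g`, so distinct grid points are `g`
  -- apart in some block.
  set θ : (Fin d → Fin m) → Fin d → ℝ := fun j l => (j l : ℕ) * g / n l with hθdef
  have hθ0 : ∀ j l, 0 ≤ θ j l := fun j l => by have := hnpos l; positivity
  have hθδ : ∀ j l, |θ j l| ≤ δ := by
    intro j l
    rw [abs_of_nonneg (hθ0 j l), hθdef, div_le_iff₀ (hnpos l)]
    have h1 : ((j l : ℕ) : ℝ) ≤ m := by exact_mod_cast (j l).isLt.le
    calc ((j l : ℕ) : ℝ) * g ≤ m * g := by gcongr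
      _ ≤ δ * N := hmN
      _ ≤ δ * n l := by gcongr; exact hi l
  set U : (Fin d → Fin m) → Fin d → (Fin T → Bool) → ℝ := fun j l s =>
    0 + ∑ t, (if i t = l then 1 else 0) * (boolSign (s t) - θ j (i t)) with hU
  have hUeq : ∀ j l s, U j l s =
      (∑ t, (if i t = l then 1 else 0) * boolSign (s t)) - (j l : ℕ) * g := by
    intro j l s
    have : ∀ t, (if i t = l then (1 : ℝ) else 0) * (boolSign (s t) - θ j (i t)) =
        (if i t = l then 1 else 0) * boolSign (s t) - (if i t = l then 1 else 0) * θ j l := by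
      intro t; split_ifs with h
      · rw [h]; ring
      · ring
    simp only [hU, this, Finset.sum_sub_distrib, ← Finset.sum_mul, hnsum, zero_add]
    have := (hnpos l).ne'
    simp only [hθdef]
    field_simp
  set P : (Fin d → Fin m) → (Fin T → Bool) → ℝ := fun j s =>
    ∏ t, ((1 + boolSign (s t) * θ j (i t)) / 2) with hP
  have hfac : ∀ (b : Bool) (x : ℝ), |x| ≤ δ → 0 < (1 + boolSign b * x) / 2 := by
    intro b x hx
    have : |boolSign b * x| < 1 := by rw [abs_mul, abs_boolSign]; linarith
    have := (abs_lt.1 this).1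
    linarith
  have hP0 : ∀ j s, 0 < P j s := fun j s => Finset.prod_pos fun t _ => hfac _ _ (hθδ _ _)
  obtain ⟨s, j, hsj⟩ := exists_mul_le_of_disjoint
    (fun s => ∏ t, ((1 + boolSign (s t) * z t s) / 2))
    (fun s => Finset.prod_pos fun t _ => hfac _ _ (hzδ _ _))
    (sum_prod_nonanticipating z hz).le P (fun j s => ∀ l, |U j l s| < g / 2)
    (by
      intro s j j' h h'
      funext l
      have h1 := h l
      have h2 := h' l
      rw [hUeq] at h1 h2
      rw [abs_lt] at h1 h2
      have ha : ((j l : ℕ) : ℝ) - (j' l : ℕ) < 1 := by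
        by_contra! hc
        nlinarith [h1.1, h2.2]
      have hb : ((j' l : ℕ) : ℝ) - (j l : ℕ) < 1 := by
        by_contra! hc
        nlinarith [h1.2, h2.1]
      have ha' : ((j l : ℕ) : ℝ) < ((j' l + 1 : ℕ) : ℝ) := by push_cast; linarith
      have hb' : ((j' l : ℕ) : ℝ) < ((j l + 1 : ℕ) : ℝ) := by push_cast; linarith
      have ha'' := Nat.cast_lt.1 ha'
      have hb'' := Nat.cast_lt.1 hb'
      apply Fin.ext
      omega)
    (by
      intro j
      -- Chebyshev with a union bound over the blocks, pointwise; the variances of all blocks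
      -- together are at most `T`.
      have hpt : ∀ s, P j s - 4 / g ^ 2 * ∑ l, P j s * U j l s ^ 2 ≤
          if ∀ l, |U j l s| < g / 2 then P j s else 0 := by
        intro s
        split_ifs with h
        · have : 0 ≤ ∑ l, P j s * U j l s ^ 2 :=
            Finset.sum_nonneg fun l _ => mul_nonneg (hP0 j s).le (sq_nonneg _)
          have : 0 ≤ 4 / g ^ 2 * ∑ l, P j s * U j l s ^ 2 := by positivity
          linarith
        · push Not at h
          obtain ⟨l, hl⟩ := h
          have h1 : P j s * U j l s ^ 2 ≤ ∑ l, P j s * U j l s ^ 2 :=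
            Finset.single_le_sum (f := fun l => P j s * U j l s ^ 2)
              (fun l _ => mul_nonneg (hP0 j s).le (sq_nonneg _)) (Finset.mem_univ l)
          have h2 : (g / 2) ^ 2 ≤ U j l s ^ 2 := by
            rw [← sq_abs (U j l s)]; gcongr
          have h3 : P j s * (g / 2) ^ 2 ≤ ∑ l, P j s * U j l s ^ 2 :=
            (mul_le_mul_of_nonneg_left h2 (hP0 j s).le).trans h1
          have h4 : 4 / g ^ 2 * (P j s * (g / 2) ^ 2) = P j s := by field_simp; ring
          have h5 : 4 / g ^ 2 * (P j s * (g / 2) ^ 2) ≤ 4 / g ^ 2 * ∑ l, P j s * U j l s ^ 2 := by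
            gcongr
          linarith
      refine le_trans ?_ (Finset.sum_le_sum fun s _ => hpt s)
      rw [Finset.sum_sub_distrib, ← Finset.mul_sum, Finset.sum_comm]
      have hone : ∑ s, P j s = 1 :=
        sum_prod_nonanticipating _ (nonanticipating_const fun t => θ j (i t))
      have hvar : ∑ l, ∑ s, P j s * U j l s ^ 2 ≤ T := by
        calc ∑ l, ∑ s, P j s * U j l s ^ 2
            = ∑ l, ∑ t, (if i t = l then (1 : ℝ) else 0) ^ 2 * (1 - θ j (i t) ^ 2) := by
              refine Finset.sum_congr rfl fun l _ => ?_
              have := sum_prod_mul_sq (fun t => θ j (i t)) (fun t => if i t = l then 1 else 0) 0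
              rw [zero_pow two_ne_zero, zero_add] at this
              exact this
          _ = ∑ t, (1 - θ j (i t) ^ 2) := by
              rw [Finset.sum_comm]
              refine Finset.sum_congr rfl fun t _ => ?_
              rw [Finset.sum_eq_single (i t)] <;> simp +contextual [eq_comm]
          _ ≤ ∑ _t : Fin T, (1 : ℝ) := Finset.sum_le_sum fun t _ => by
              linarith [sq_nonneg (θ j (i t))]
          _ = T := by simp
      rw [hone, hg2]
      have : 4 / (8 * (T : ℝ)) * ∑ l, ∑ s, P j s * U j l s ^ 2 ≤ 4 / (8 * (T : ℝ)) * T := by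
        gcongr
      have h6 : 4 / (8 * (T : ℝ)) * T = 1 / 2 := by field_simp; norm_num
      linarith)
  refine ⟨s, θ j, hθδ j, ?_⟩
  simp only [hP, Finset.prod_div_distrib, Fintype.card_pi, Fintype.card_fin,
    Finset.prod_const, Finset.card_univ, Nat.cast_pow] at hsj
  rwa [← mul_div_assoc, div_le_div_iff_of_pos_right (by positivity)] at hsj


/-! ### Reduction to mean actions -/

/-- By Jensen's inequality the expected regret of a randomized algorithm is at least the regret
of its mean actions. -/
lemma OCOAlgorithm.integrable_regret_and_le {d T : ℕ} {X : Set (EuclideanSpace ℝ (Fin d))}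
    (hXc : IsCompact X) (hX : Convex ℝ X) {Ω : Type*} [MeasurableSpace Ω] (P : Measure Ω)
    [IsProbabilityMeasure P] (A : OCOAlgorithm X Ω) (f : Fin T → EuclideanSpace ℝ (Fin d) → ℝ)
    (hf : ∀ t, ConvexOn ℝ X (f t)) (hfc : ∀ t, ContinuousOn (f t) X)
    (hfm : ∀ t, Measurable (f t)) :
    Integrable (A.regret f) P ∧ (∀ t, ∫ ω, A.action f t ω ∂P ∈ X) ∧
      ∀ x ∈ X, ∑ t, f t (∫ ω, A.action f t ω ∂P) - ∑ t, f t x ≤ ∫ ω, A.regret f ω ∂P := by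
  have hmem : ∀ t ω, A.action f t ω ∈ X := fun t ω => A.play_mem _ _ _
  have hmeas : ∀ t, Measurable (A.action f t) := fun t => A.measurable_play _ _
  have hint : ∀ t, Integrable (A.action f t) P := by
    intro t
    obtain ⟨C, hC⟩ := hXc.isBounded.exists_norm_le
    exact Integrable.of_bound (hmeas t).aestronglyMeasurable C
      (Filter.Eventually.of_forall fun ω => hC _ (hmem t ω))
  have hfint : ∀ t, Integrable (fun ω => f t (A.action f t ω)) P := by
    intro t
    obtain ⟨C, hC⟩ := (hXc.image_of_continuousOn (hfc t)).isBounded.exists_norm_le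
    exact Integrable.of_bound ((hfm t).comp (hmeas t)).aestronglyMeasurable C
      (Filter.Eventually.of_forall fun ω => hC _ ⟨_, hmem t ω, rfl⟩)
  have hsum : Integrable (fun ω => ∑ t, f t (A.action f t ω)) P :=
    integrable_finsetSum _ fun t _ => hfint t
  refine ⟨hsum.sub (integrable_const _), fun t => ?_, fun x hx => ?_⟩
  · exact hX.integral_mem hXc.isClosed (Filter.Eventually.of_forall (hmem t)) (hint t)
  · have hJ : ∀ t, f t (∫ ω, A.action f t ω ∂P) ≤ ∫ ω, f t (A.action f t ω) ∂P := fun t =>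
      (hf t).map_integral_le (hfc t) hXc.isClosed (Filter.Eventually.of_forall (hmem t))
        (hint t) (hfint t)
    have hbdd : BddBelow ((fun x => ∑ t, f t x) '' X) :=
      (hXc.image_of_continuousOn (continuousOn_finsetSum _ fun t _ => hfc t)).bddBelow
    have hinf : sInf ((fun x => ∑ t, f t x) '' X) ≤ ∑ t, f t x := csInf_le hbdd ⟨x, hx, rfl⟩
    have hE : ∫ ω, A.regret f ω ∂P =
        ∑ t, ∫ ω, f t (A.action f t ω) ∂P - sInf ((fun x => ∑ t, f t x) '' X) := by
      unfold OCOAlgorithm.regret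
      rw [integral_sub hsum (integrable_const _), integral_finsetSum _ fun t _ => hfint t]
      simp
    rw [hE]
    have := Finset.sum_le_sum fun t (_ : t ∈ Finset.univ) => hJ t
    linarith

/-- The mean actions against losses chosen by signs are nonanticipating. -/
lemma OCOAlgorithm.integral_action_congr {d T : ℕ} {X : Set (EuclideanSpace ℝ (Fin d))}
    {Ω : Type*} [MeasurableSpace Ω] (P : Measure Ω) (A : OCOAlgorithm X Ω)
    (g : Fin T → Bool → EuclideanSpace ℝ (Fin d) → ℝ) (t : Fin T) (s s' : Fin T → Bool)
    (h : ∀ r, r < t → s r = s' r) :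
    ∫ ω, A.action (fun t => g t (s t)) t ω ∂P = ∫ ω, A.action (fun t => g t (s' t)) t ω ∂P := by
  unfold OCOAlgorithm.action
  have : (fun r : Fin t => g (Fin.castLE t.isLt.le r) (s (Fin.castLE t.isLt.le r))) =
      fun r : Fin t => g (Fin.castLE t.isLt.le r) (s' (Fin.castLE t.isLt.le r)) := by
    funext r
    rw [h _ (Fin.lt_def.2 r.isLt)]
  simp only [this]

/-! ### The cube -/

/-- The cube of half side `r` centred at the origin. -/
def cube (d : ℕ) (r : ℝ) : Set (EuclideanSpace ℝ (Fin d)) := {x | ∀ l, |x l| ≤ r}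

lemma convex_cube (d : ℕ) (r : ℝ) : Convex ℝ (cube d r) := by
  intro x hx y hy a b ha hb hab l
  calc |(a • x + b • y) l| = |a * x l + b * y l| := by simp
    _ ≤ |a * x l| + |b * y l| := abs_add_le _ _
    _ = a * |x l| + b * |y l| := by rw [abs_mul, abs_mul, abs_of_nonneg ha, abs_of_nonneg hb]
    _ ≤ a * r + b * r := by gcongr; exacts [hx l, hy l]
    _ = r := by rw [← add_mul, hab, one_mul]

lemma norm_sub_le_of_mem_cube {d : ℕ} {r : ℝ} (hr : 0 ≤ r) {x y : EuclideanSpace ℝ (Fin d)}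
    (hx : x ∈ cube d r) (hy : y ∈ cube d r) : ‖x - y‖ ≤ 2 * r * √d := by
  rw [EuclideanSpace.norm_eq]
  calc √(∑ l, ‖(x - y) l‖ ^ 2) ≤ √(∑ _l : Fin d, (2 * r) ^ 2) := by
        gcongr with l
        calc ‖(x - y) l‖ = |x l - y l| := by simp
          _ ≤ |x l| + |y l| := abs_sub _ _
          _ ≤ 2 * r := by linarith [hx l, hy l]
    _ = 2 * r * √d := by
        rw [Finset.sum_const, Finset.card_univ, Fintype.card_fin, nsmul_eq_mul, mul_comm,
          Real.sqrt_mul (by positivity), Real.sqrt_sq (by positivity)]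

lemma zero_mem_cube {d : ℕ} {r : ℝ} (hr : 0 ≤ r) : (0 : EuclideanSpace ℝ (Fin d)) ∈ cube d r :=
  fun l => by simpa using hr

lemma isCompact_cube (d : ℕ) {r : ℝ} (hr : 0 ≤ r) : IsCompact (cube d r) := by
  refine Metric.isCompact_of_isClosed_isBounded ?_ ?_
  · have : cube d r = ⋂ l, {x : EuclideanSpace ℝ (Fin d) | |x l| ≤ r} := by
      ext x; simp [cube]
    rw [this]
    exact isClosed_iInter fun l => isClosed_le (by fun_prop) continuous_const
  · refine isBounded_iff_forall_norm_le.2 ⟨2 * r * √d, fun x hx => ?_⟩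
    simpa using norm_sub_le_of_mem_cube hr hx (zero_mem_cube hr)

lemma norm_gradient {d : ℕ} (f : EuclideanSpace ℝ (Fin d) → ℝ) (x : EuclideanSpace ℝ (Fin d)) :
    ‖gradient f x‖ = ‖fderiv ℝ f x‖ := by
  unfold gradient; exact LinearIsometryEquiv.norm_map _ _

/-! ### Logarithmic losses -/

/-- The logarithmic loss of predicting the sign `b` by `β * x l`. -/
noncomputable def logLoss {d : ℕ} (α β : ℝ) (l : Fin d) (b : Bool) (x : EuclideanSpace ℝ (Fin d)) : ℝ :=
  -(1 / α) * Real.log (1 + boolSign b * (β * x l))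

section LogLoss

variable {d : ℕ} {α β r G : ℝ} (l : Fin d) (b : Bool)

lemma half_le_of_mem_cube (hβ : 0 ≤ β) (hβr : β * r ≤ 1 / 2) {x : EuclideanSpace ℝ (Fin d)}
    (hx : x ∈ cube d r) : 1 / 2 ≤ 1 + boolSign b * (β * x l) := by
  have h : |boolSign b * (β * x l)| ≤ 1 / 2 := by
    rw [abs_mul, abs_boolSign, one_mul, abs_mul, abs_of_nonneg hβ]
    exact (mul_le_mul_of_nonneg_left (hx l) hβ).trans hβr
  linarith [(abs_le.1 h).1]

/-- `exp (-α f)` is affine on the cube, so concavity holds with equality. -/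
lemma expConcaveOn_logLoss (hα : 0 < α) (hβ : 0 ≤ β) (hβr : β * r ≤ 1 / 2) :
    ExpConcaveOn α (cube d r) (logLoss α β l b) := by
  have h : Set.EqOn (fun x : EuclideanSpace ℝ (Fin d) => 1 + boolSign b * (β * x l))
      (fun x => Real.exp (-α * logLoss α β l b x)) (cube d r) := by
    intro x hx
    have h1 := half_le_of_mem_cube l b hβ hβr hx
    have h2 : -α * logLoss α β l b x = Real.log (1 + boolSign b * (β * x l)) := by
      unfold logLoss; field_simp
    simp only [h2]
    rw [Real.exp_log (by linarith)]
  refine ConcaveOn.congr ⟨convex_cube d r, fun x _ y _ u v _ _ huv => le_of_eq ?_⟩ h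
  simp only [PiLp.add_apply, PiLp.smul_apply, smul_eq_mul]
  linear_combination huv

lemma convexOn_logLoss (hα : 0 < α) (hβ : 0 ≤ β) (hβr : β * r ≤ 1 / 2) :
    ConvexOn ℝ (cube d r) (logLoss α β l b) := by
  refine ⟨convex_cube d r, fun x hx y hy u v hu hv huv => ?_⟩
  have h1 := half_le_of_mem_cube l b hβ hβr hx
  have h2 := half_le_of_mem_cube l b hβ hβr hy
  have h := strictConcaveOn_log_Ioi.concaveOn.2 (x := 1 + boolSign b * (β * x l))
    (y := 1 + boolSign b * (β * y l)) (by simp only [Set.mem_Ioi]; linarith)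
    (by simp only [Set.mem_Ioi]; linarith) hu hv huv
  have e : u • (1 + boolSign b * (β * x l)) + v • (1 + boolSign b * (β * y l)) =
      1 + boolSign b * (β * (u • x + v • y) l) := by
    simp only [PiLp.add_apply, PiLp.smul_apply, smul_eq_mul]
    linear_combination huv
  rw [e] at h
  simp only [smul_eq_mul] at h
  simp only [logLoss, smul_eq_mul] at *
  have := mul_le_mul_of_nonneg_left h (one_div_pos.2 hα).le
  linarith

lemma norm_proj_le : ‖(EuclideanSpace.proj l : EuclideanSpace ℝ (Fin d) →L[ℝ] ℝ)‖ ≤ 1 :=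
  ContinuousLinearMap.opNorm_le_bound _ zero_le_one fun x => by
    simpa using PiLp.norm_apply_le x l

lemma hasFDerivAt_logLoss {x : EuclideanSpace ℝ (Fin d)}
    (hx : 1 + boolSign b * (β * x l) ≠ 0) :
    HasFDerivAt (logLoss α β l b) ((-(1 / α) * ((1 + boolSign b * (β * x l))⁻¹ *
      (boolSign b * β))) • (EuclideanSpace.proj l : EuclideanSpace ℝ (Fin d) →L[ℝ] ℝ)) x := by
  have h0 : HasFDerivAt (fun y : EuclideanSpace ℝ (Fin d) => y l)
      (EuclideanSpace.proj l : EuclideanSpace ℝ (Fin d) →L[ℝ] ℝ) x :=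
    (EuclideanSpace.proj l : EuclideanSpace ℝ (Fin d) →L[ℝ] ℝ).hasFDerivAt
  have h := ((((h0.const_mul β).const_mul (boolSign b)).const_add 1).log hx).const_mul (-(1 / α))
  simp only [smul_smul] at h ⊢
  exact h

lemma norm_gradient_logLoss_le (hα : 0 < α) (hβ : 0 ≤ β) (hβr : β * r ≤ 1 / 2)
    (hG : 2 * β ≤ α * G) {x : EuclideanSpace ℝ (Fin d)} (hx : x ∈ cube d r) :
    DifferentiableAt ℝ (logLoss α β l b) x ∧ ‖gradient (logLoss α β l b) x‖ ≤ G := by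
  have h1 := half_le_of_mem_cube l b hβ hβr hx
  set w := 1 + boolSign b * (β * x l) with hw
  have hw0 : 0 < w := by linarith
  have h := hasFDerivAt_logLoss (α := α) l b hw0.ne'
  refine ⟨h.differentiableAt, ?_⟩
  rw [norm_gradient, h.fderiv, norm_smul]
  have hinv : w⁻¹ ≤ 2 := by
    rw [inv_le_comm₀ hw0 two_pos]; linarith
  calc _ ≤ ‖-(1 / α) * (w⁻¹ * (boolSign b * β))‖ * 1 := by
        gcongr; exact norm_proj_le l
    _ = 1 / α * (w⁻¹ * β) := by
        rw [mul_one, norm_mul, norm_neg, norm_mul, norm_mul, Real.norm_eq_abs (boolSign b),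
          abs_boolSign, one_mul, Real.norm_of_nonneg hβ, Real.norm_of_nonneg (inv_pos.2 hw0).le,
          Real.norm_of_nonneg (one_div_pos.2 hα).le]
    _ ≤ 1 / α * (2 * β) := by gcongr
    _ ≤ 1 / α * (α * G) := by gcongr
    _ = G := by field_simp

lemma measurable_logLoss : Measurable (logLoss (d := d) α β l b) := by
  unfold logLoss
  have : Measurable fun x : EuclideanSpace ℝ (Fin d) => x l :=
    (EuclideanSpace.proj l : EuclideanSpace ℝ (Fin d) →L[ℝ] ℝ).measurable
  fun_prop

end LogLoss

/-- Logarithmic losses force regret `log (m ^ d / 2) / α`. -/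
lemma exists_logLoss_regret_ge {T d m : ℕ} (hm : 0 < m) (hT : 0 < T) (i : Fin T → Fin d)
    {α β r N : ℝ} (hα : 0 < α) (hβ : 0 < β) (hr : 0 < r) (hβr : β * r ≤ 1 / 2) (hN : 0 < N)
    (hi : ∀ l, N ≤ ((Finset.univ.filter fun t => i t = l).card : ℝ))
    (hmN : m * √(8 * T) ≤ β * r * N) {Ω : Type*} [MeasurableSpace Ω] (P : Measure Ω)
    [IsProbabilityMeasure P] (A : OCOAlgorithm (cube d r) Ω) :
    ∃ s : Fin T → Bool, Integrable (A.regret fun t => logLoss α β (i t) (s t)) P ∧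
      1 / α * Real.log ((m : ℝ) ^ d / 2) ≤
        ∫ ω, A.regret (fun t => logLoss α β (i t) (s t)) ω ∂P := by
  have hred := fun s : Fin T → Bool => A.integrable_regret_and_le (isCompact_cube d hr.le)
    (convex_cube d r) P (fun t => logLoss α β (i t) (s t))
    (fun t => convexOn_logLoss _ _ hα hβ.le hβr)
    (fun t x hx => ((norm_gradient_logLoss_le (G := 2 * β / α) _ _ hα hβ.le hβr
      (by field_simp; rfl) hx).1.continuousAt).continuousWithinAt)
    (fun t => measurable_logLoss _ _)
  set X : Fin T → (Fin T → Bool) → EuclideanSpace ℝ (Fin d) := fun t s =>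
    ∫ ω, A.action (fun t => logLoss α β (i t) (s t)) t ω ∂P with hX
  have hXmem : ∀ t s, X t s ∈ cube d r := fun t s => (hred s).2.1 t
  obtain ⟨s, θ, hθ, h⟩ := exists_prod_le_prod hm hT i (β * r) N (by linarith) hN hi hmN
    (fun t s => β * X t s (i t))
    (fun t s s' h => by
      simp only [hX]
      rw [A.integral_action_congr P (fun t b => logLoss α β (i t) b) t s s' h])
    (fun t s => by
      rw [abs_mul, abs_of_pos hβ]
      exact mul_le_mul_of_nonneg_left (hXmem t s _) hβ.le)
  refine ⟨s, (hred s).1, ?_⟩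
  -- The comparator is the point that predicts the winning parameters; it lies in the cube as `|θ l|
  -- ≤ β * r`.
  set x : EuclideanSpace ℝ (Fin d) := WithLp.toLp 2 fun l => θ l / β with hx
  have hxl : ∀ l, β * x l = θ l := fun l => by simp only [hx]; field_simp
  have hxmem : x ∈ cube d r := by
    intro l
    have := hθ l
    rw [← hxl, abs_mul, abs_of_pos hβ] at this
    exact le_of_mul_le_mul_left this hβ
  refine le_trans ?_ ((hred s).2.2 x hxmem)
  have hpos : ∀ (t : Fin T) (y : EuclideanSpace ℝ (Fin d)), y ∈ cube d r →
      0 < 1 + boolSign (s t) * (β * y (i t)) := fun t y hy => by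
    have := half_le_of_mem_cube (i t) (s t) hβ.le hβr hy
    linarith
  have hq : 0 < ∏ t, (1 + boolSign (s t) * (β * X t s (i t))) :=
    Finset.prod_pos fun t _ => hpos t _ (hXmem t s)
  have hmpos : 0 < (m : ℝ) ^ d / 2 := by
    have : (0 : ℝ) < m := by exact_mod_cast hm
    positivity
  have hlog := Real.log_le_log (mul_pos hmpos hq) h
  simp only [← hxl] at hlog
  rw [Real.log_mul hmpos.ne' hq.ne', Real.log_prod fun t _ => (hpos t _ (hXmem t s)).ne',
    Real.log_prod fun t _ => (hpos t x hxmem).ne'] at hlog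
  have := mul_le_mul_of_nonneg_left hlog (one_div_pos.2 hα).le
  have e1 : ∑ t, logLoss α β (i t) (s t) (X t s) =
      -(1 / α) * ∑ t, Real.log (1 + boolSign (s t) * (β * X t s (i t))) := by
    rw [Finset.mul_sum]; rfl
  have e2 : ∑ t, logLoss α β (i t) (s t) x =
      -(1 / α) * ∑ t, Real.log (1 + boolSign (s t) * (β * x (i t))) := by
    rw [Finset.mul_sum]; rfl
  rw [e1, e2]
  linarith

/-! ### Linear losses -/

/-- The linear loss `x ↦ ±c * ∑ l, x l`. -/
noncomputable def linLoss {d : ℕ} (c : ℝ) (b : Bool) (x : EuclideanSpace ℝ (Fin d)) : ℝ :=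
  c * boolSign b * ∑ l, x l

section LinLoss

variable {d : ℕ} (c : ℝ) (b : Bool)

lemma linLoss_eq_inner : linLoss (d := d) c b =
    fun x => inner ℝ (WithLp.toLp 2 fun _ => c * boolSign b : EuclideanSpace ℝ (Fin d)) x := by
  funext x
  simp only [linLoss, PiLp.inner_apply, Finset.mul_sum]
  exact Finset.sum_congr rfl fun l _ => by simp [mul_comm]

lemma differentiable_linLoss : Differentiable ℝ (linLoss (d := d) c b) := by
  unfold linLoss; fun_prop

lemma norm_gradient_linLoss (x : EuclideanSpace ℝ (Fin d)) :
    ‖gradient (linLoss c b) x‖ = |c| * √d := by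
  have h : HasGradientAt (linLoss c b)
      (WithLp.toLp 2 fun _ => c * boolSign b : EuclideanSpace ℝ (Fin d)) x := by
    rw [linLoss_eq_inner]
    exact ((InnerProductSpace.toDual ℝ (EuclideanSpace ℝ (Fin d))) _).hasFDerivAt
  rw [h.gradient, EuclideanSpace.norm_eq]
  simp [abs_boolSign, Real.sqrt_sq_eq_abs, mul_comm]

lemma convexOn_linLoss {X : Set (EuclideanSpace ℝ (Fin d))} (hX : Convex ℝ X) :
    ConvexOn ℝ X (linLoss c b) := by
  refine ⟨hX, fun x _ y _ u v _ _ _ => le_of_eq ?_⟩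
  simp only [linLoss, PiLp.add_apply, PiLp.smul_apply, smul_eq_mul, Finset.sum_add_distrib,
    ← Finset.mul_sum]
  ring

end LinLoss

/-- Linear losses with coefficients `c t` force regret of the order of `√(∑ t, c t ^ 2)`. -/
lemma exists_linLoss_regret_ge {T d : ℕ} (c : Fin T → ℝ) {r : ℝ} (hr : 0 < r) {Ω : Type*}
    [MeasurableSpace Ω] (P : Measure Ω) [IsProbabilityMeasure P]
    (A : OCOAlgorithm (cube d r) Ω) :
    ∃ s : Fin T → Bool, Integrable (A.regret fun t => linLoss (c t) (s t)) P ∧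
      5 / 9 * (d * r) * √(∑ t, c t ^ 2) ≤
        ∫ ω, A.regret (fun t => linLoss (c t) (s t)) ω ∂P := by
  have hred := fun s : Fin T → Bool => A.integrable_regret_and_le (isCompact_cube d hr.le)
    (convex_cube d r) P (fun t => linLoss (c t) (s t))
    (fun t => convexOn_linLoss _ _ (convex_cube d r))
    (fun t => (differentiable_linLoss _ _).continuous.continuousOn)
    (fun t => (differentiable_linLoss _ _).continuous.measurable)
  set z : Fin T → (Fin T → Bool) → ℝ := fun t s =>
    c t * ∑ l, (∫ ω, A.action (fun t => linLoss (c t) (s t)) t ω ∂P) l with hz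
  have hzn : Nonanticipating z := fun t s s' h => by
    simp only [hz]
    rw [A.integral_action_congr P (fun t b => linLoss (c t) b) t s s' h]
  have hreg : ∀ s : Fin T → Bool, ∑ t, boolSign (s t) * z t s +
      d * r * |∑ t, c t * boolSign (s t)| ≤
        ∫ ω, A.regret (fun t => linLoss (c t) (s t)) ω ∂P := by
    intro s
    -- The comparator is the corner of the diagonal opposite to the total coefficient.
    set σ : ℝ := if 0 ≤ ∑ t, c t * boolSign (s t) then -1 else 1 with hσ
    have hσabs : |σ| = 1 := by rw [hσ]; split_ifs <;> simp
    have hσS : σ * ∑ t, c t * boolSign (s t) = -|∑ t, c t * boolSign (s t)| := by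
      rw [hσ]; split_ifs with h
      · rw [abs_of_nonneg h]; ring
      · rw [abs_of_neg (not_le.1 h)]; ring
    have h := (hred s).2.2 (WithLp.toLp 2 fun _ => σ * r)
      (fun l => by simp [abs_mul, hσabs, abs_of_pos hr])
    refine le_trans (le_of_eq ?_) h
    have e : ∑ t, linLoss (c t) (s t) (WithLp.toLp 2 fun _ => σ * r : EuclideanSpace ℝ (Fin d)) =
        (σ * ∑ t, c t * boolSign (s t)) * (d * r) := by
      simp only [linLoss, ← Finset.sum_mul, Finset.sum_const, Finset.card_univ, Fintype.card_fin,
        nsmul_eq_mul]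
      ring
    rw [e, hσS, neg_mul, sub_neg_eq_add, mul_comm (d * r : ℝ)]
    congr 1
    refine Finset.sum_congr rfl fun t _ => ?_
    simp only [hz, linLoss]
    ring
  -- Averaged over all signs, the algorithm's own loss vanishes and only the random walk remains.
  obtain ⟨s, -, hs⟩ := Finset.exists_le_of_sum_le (s := (Finset.univ : Finset (Fin T → Bool)))
    (f := fun _ => 5 / 9 * (d * r) * √(∑ t, c t ^ 2))
    (g := fun s => ∑ t, boolSign (s t) * z t s + d * r * |∑ t, c t * boolSign (s t)|)
    Finset.univ_nonempty (by
      rw [Finset.sum_add_distrib, sum_sum_nonanticipating z hzn, zero_add]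
      simp only [Finset.sum_const, Finset.card_univ, Fintype.card_pi, Fintype.card_bool,
        Finset.prod_const, Fintype.card_fin, nsmul_eq_mul]
      push_cast
      rw [← Finset.mul_sum]
      calc (2 : ℝ) ^ T * (5 / 9 * (d * r) * √(∑ t, c t ^ 2))
          = d * r * (2 ^ T * (5 / 9 * √(∑ t, c t ^ 2))) := by ring
        _ ≤ _ := by gcongr; exact sum_abs_signs_ge c)
  exact ⟨s, (hred s).1, hs.trans (hreg s)⟩


/-! ### Block sizes, grid size and the final case distinction -/

lemma div_le_card_filter_mod {T d : ℕ} (hd : 0 < d) (l : Fin d) :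
    T / d ≤ (Finset.univ.filter fun t : Fin T =>
      (⟨(t : ℕ) % d, Nat.mod_lt _ hd⟩ : Fin d) = l).card := by
  have hlt : ∀ q, q < T / d → d * q + l < T := fun q hq => by
    calc d * q + l < d * q + d := by have := l.isLt; omega
      _ = d * (q + 1) := by ring
      _ ≤ d * (T / d) := Nat.mul_le_mul_left _ hq
      _ ≤ T := Nat.mul_div_le T d
  have := Finset.card_le_card_of_injOn (s := (Finset.univ : Finset (Fin (T / d))))
    (t := Finset.univ.filter fun t : Fin T =>
      (⟨(t : ℕ) % d, Nat.mod_lt _ hd⟩ : Fin d) = l)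
    (fun q => ⟨d * q + l, hlt q q.isLt⟩)
    (fun q _ => by
      simp only [Finset.coe_filter, Finset.mem_univ, true_and, Set.mem_ofPred_eq]
      apply Fin.ext
      simp [Nat.mod_eq_of_lt l.isLt])
    (fun q _ q' _ h => by
      have h' : d * (q : ℕ) + l = d * (q' : ℕ) + l := congrArg Fin.val h
      exact Fin.ext (Nat.eq_of_mul_eq_mul_left hd (by omega)))
  simpa using this

/-- For large `T` there is a grid size `m` of the order of `T ^ (1 / 4)` fine enough for
`exists_prod_le_prod`. -/
lemma exists_grid {d : ℕ} (hd : 1 ≤ d) {δ : ℝ} (hδ : 0 < δ) (hδ' : δ ≤ 1 / 2) {T : ℕ}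
    (hT : (18 * d / δ) ^ 4 ≤ (T : ℝ)) :
    ∃ m : ℕ, 0 < m ∧ 0 < T ∧ 0 < ((T / d : ℕ) : ℝ) ∧ m * √(8 * T) ≤ δ * ((T / d : ℕ) : ℝ) ∧
      d / 4 * Real.log T ≤ Real.log ((m : ℝ) ^ d / 2) := by
  have hd1 : (1 : ℝ) ≤ d := by exact_mod_cast hd
  have hd0 : (0 : ℝ) < d := by linarith
  set u : ℝ := √(√(T : ℝ)) with hu
  have hu4 : (T : ℝ) = u ^ 4 := by
    rw [show u ^ 4 = (u ^ 2) ^ 2 by ring, hu, Real.sq_sqrt (Real.sqrt_nonneg _),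
      Real.sq_sqrt (Nat.cast_nonneg _)]
  have hu0 : 0 ≤ u := Real.sqrt_nonneg _
  have hu1 : 18 * d / δ ≤ u := by
    rw [hu4] at hT
    exact (pow_le_pow_iff_left₀ (by positivity) hu0 (by norm_num)).1 hT
  have hδu : 18 * d ≤ δ * u := by rwa [div_le_iff₀' hδ] at hu1
  have hud : 36 * (d : ℝ) ≤ u := by nlinarith
  have hupos : 0 < u := by linarith
  have hone : 1 ≤ u := by linarith
  have hT0 : 0 < T := by
    have : (0 : ℝ) < T := by rw [hu4]; positivity
    exact_mod_cast this
  have huT : u ≤ u ^ 4 := le_self_pow₀ hone (by norm_num)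
  have hN : u ^ 4 / (2 * d) ≤ ((T / d : ℕ) : ℝ) := by
    have h1 : (T : ℝ) / d < ((T / d : ℕ) : ℝ) + 1 := by
      rw [div_lt_iff₀ hd0]
      have := Nat.lt_mul_div_succ T (Nat.lt_of_lt_of_le Nat.zero_lt_one hd)
      rw [mul_comm]
      exact_mod_cast this
    have h2 : 1 ≤ u ^ 4 / (2 * d) := by
      rw [le_div_iff₀ (by positivity)]; linarith
    have h3 : (T : ℝ) / d = 2 * (u ^ 4 / (2 * d)) := by rw [hu4]; field_simp
    linarith
  have hm2 : 2 * u ≤ (⌈2 * u⌉₊ : ℝ) := Nat.le_ceil _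
  have hm3 : (⌈2 * u⌉₊ : ℝ) ≤ 3 * u := by
    have := Nat.ceil_lt_add_one (a := 2 * u) (by positivity)
    linarith
  -- The factor `2` absorbs the `/ 2` in `m ^ d / 2`. Since `m ≤ 3 * u` and `√(8 * T) ≤ 3 * u ^ 2`,
  -- the fineness condition reduces to `18 * d ≤ δ * u`.
  refine ⟨⌈2 * u⌉₊, Nat.ceil_pos.2 (by positivity), hT0, lt_of_lt_of_le (by positivity) hN,
    ?_, ?_⟩
  · have hs : √(8 * (T : ℝ)) ≤ 3 * u ^ 2 := by
      rw [hu4]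
      apply Real.sqrt_le_iff.2 ⟨by positivity, ?_⟩
      have : 0 ≤ u ^ 4 := by positivity
      nlinarith
    calc (⌈2 * u⌉₊ : ℝ) * √(8 * (T : ℝ)) ≤ 3 * u * (3 * u ^ 2) := by gcongr
      _ = 18 * d * u ^ 3 / (2 * d) := by field_simp; ring
      _ ≤ δ * u * u ^ 3 / (2 * d) := by gcongr
      _ = δ * (u ^ 4 / (2 * d)) := by ring
      _ ≤ δ * ((T / d : ℕ) : ℝ) := by gcongr
  · have hlog : Real.log T = 4 * Real.log u := by
      rw [hu4, Real.log_pow]; norm_num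
    calc d / 4 * Real.log T = d * Real.log u := by rw [hlog]; ring
      _ = Real.log (u ^ d) := by rw [Real.log_pow]
      _ ≤ Real.log ((⌈2 * u⌉₊ : ℝ) ^ d / 2) := by
        apply Real.log_le_log (by positivity)
        rw [le_div_iff₀ two_pos]
        calc u ^ d * 2 ≤ u ^ d * 2 ^ d := by
              gcongr; exact le_self_pow₀ (by norm_num) (by omega)
          _ = (2 * u) ^ d := by rw [mul_pow, mul_comm]
          _ ≤ _ := by gcongr

theorem mainTheorem7 :
    ∃ c : ℝ, 0 < c ∧
      ∀ d : ℕ, 1 ≤ d → ∀ D : ℝ, 0 < D →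
        ∃ X : Set (EuclideanSpace ℝ (Fin d)),
          X.Nonempty ∧ IsCompact X ∧ Convex ℝ X ∧ (∀ x ∈ X, ∀ y ∈ X, ‖x - y‖ ≤ D) ∧
          ∀ G : ℝ, 0 < G → ∀ α : ℝ, 0 < α →
            ∃ T₀ : ℕ, ∀ T : ℕ, T₀ ≤ T → ∀ k : ℕ, k ≤ T →
              ∀ (Ω : Type*) [MeasurableSpace Ω] (P : Measure Ω) [IsProbabilityMeasure P]
                (A : OCOAlgorithm X Ω),
                ∃ f : Fin T → EuclideanSpace ℝ (Fin d) → ℝ,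
                  IsContaminated X {g | ExpConcaveOn α X g} k f ∧
                  (∀ t, ∀ x ∈ X, DifferentiableAt ℝ (f t) x ∧ ‖gradient (f t) x‖ ≤ G) ∧
                  Integrable (A.regret f) P ∧
                  c * ((d : ℝ) / α * Real.log T + G * D * Real.sqrt k) ≤
                    ∫ ω, A.regret f ω ∂P := by
  -- The two cases yield the factors `1 / 4` and `5 / 18 ≥ 1 / 4` on the larger term, hence `1 / 8`
  -- on the sum.
  refine ⟨1 / 8, by norm_num, fun d hd D hD => ?_⟩
  have hd0 : (0 : ℝ) < d := by exact_mod_cast hd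
  have hsd : 0 < √(d : ℝ) := Real.sqrt_pos.2 hd0
  have hsd2 : √(d : ℝ) * √(d : ℝ) = d := Real.mul_self_sqrt hd0.le
  set r := D / (2 * √(d : ℝ)) with hrdef
  have hr : 0 < r := by positivity
  have hrD : 2 * r * √(d : ℝ) = D := by rw [hrdef]; field_simp
  refine ⟨cube d r, ⟨0, zero_mem_cube hr.le⟩, isCompact_cube d hr.le, convex_cube d r,
    fun x hx y hy => (norm_sub_le_of_mem_cube hr.le hx hy).trans hrD.le, fun G hG α hα => ?_⟩
  -- The first bound keeps gradients below `G`, the second keeps the argument of the logarithm above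
  -- `1 / 2`.
  set β := min (α * G / 2) (1 / (2 * r)) with hβdef
  have hβ : 0 < β := lt_min (by positivity) (by positivity)
  have hβG : 2 * β ≤ α * G := by
    have : β ≤ α * G / 2 := min_le_left _ _
    linarith
  have hβr : β * r ≤ 1 / 2 := by
    calc β * r ≤ 1 / (2 * r) * r := by gcongr; exact min_le_right _ _
      _ = 1 / 2 := by field_simp
  refine ⟨⌈(18 * d / (β * r)) ^ 4⌉₊, fun T hT k hk Ω _ P _ A => ?_⟩
  obtain ⟨I, -, hI⟩ := Finset.exists_subset_card_eq
    (s := (Finset.univ : Finset (Fin T))) (n := k) (by simpa using hk)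
  rcases le_total (G * D * √(k : ℝ)) (d / α * Real.log T) with hcmp | hcmp
  · obtain ⟨m, hm, hT0, hN, hmN, hlog⟩ := exists_grid hd (mul_pos hβ hr) hβr (Nat.ceil_le.1 hT)
    obtain ⟨s, hint, hs⟩ := exists_logLoss_regret_ge hm hT0
      (fun t => ⟨(t : ℕ) % d, Nat.mod_lt _ hd⟩) hα hβ hr hβr hN
      (fun l => by exact_mod_cast div_le_card_filter_mod hd l) hmN P A
    refine ⟨_, ⟨fun t => convexOn_logLoss _ _ hα hβ.le hβr, I, hI,
      fun t _ => expConcaveOn_logLoss _ _ hα hβ.le hβr⟩,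
      fun t x hx => norm_gradient_logLoss_le _ _ hα hβ.le hβr hβG hx, hint, le_trans ?_ hs⟩
    have h1 : 1 / α * (d / 4 * Real.log T) ≤ 1 / α * Real.log ((m : ℝ) ^ d / 2) := by gcongr
    have h2 : 1 / α * (d / 4 * Real.log T) = 1 / 4 * (d / α * Real.log T) := by ring
    linarith
  · set c : Fin T → ℝ := fun t => if t ∈ I then G / √(d : ℝ) else 0 with hc
    have hcabs : ∀ t, |c t| ≤ G / √(d : ℝ) := by
      intro t
      simp only [hc]
      split_ifs
      · rw [abs_of_nonneg (by positivity)]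
      · rw [abs_zero]; positivity
    have hcsum : ∑ t, c t ^ 2 = k * (G / √(d : ℝ)) ^ 2 := by
      simp [hc, ite_pow, hI]
    obtain ⟨s, hint, hs⟩ := exists_linLoss_regret_ge c hr P A
    refine ⟨_, ⟨fun t => convexOn_linLoss _ _ (convex_cube d r), I, hI, fun t ht => ?_⟩,
      fun t x _ => ⟨differentiable_linLoss _ _ x, ?_⟩, hint, le_trans ?_ hs⟩
    -- Outside `I` the loss is zero, hence trivially exp-concave.
    · have : (fun x : EuclideanSpace ℝ (Fin d) => Real.exp (-α * linLoss (c t) (s t) x)) =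
          fun _ => 1 := by
        funext x; simp [linLoss, hc, ht]
      simp only [Set.mem_ofPred_eq, ExpConcaveOn, this]
      exact concaveOn_const 1 (convex_cube d r)
    · rw [norm_gradient_linLoss]
      calc |c t| * √(d : ℝ) ≤ G / √(d : ℝ) * √(d : ℝ) := by gcongr; exact hcabs t
        _ = G := by field_simp
    · have hval : 5 / 9 * (d * r) * √(∑ t, c t ^ 2) = 5 / 18 * (G * D * √(k : ℝ)) := by
        have e : (d : ℝ) * (G / √(d : ℝ)) = G * √(d : ℝ) := by
          rw [← mul_div_assoc, div_eq_iff hsd.ne', mul_assoc, hsd2, mul_comm]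
        rw [hcsum, Real.sqrt_mul (Nat.cast_nonneg _), Real.sqrt_sq (by positivity), ← hrD]
        linear_combination 5 / 9 * r * √(k : ℝ) * e
      have h0 : 0 ≤ G * D * √(k : ℝ) := by positivity
      rw [hval]
      linarith
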